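/- **Pfaffian formula for boundary correlations (Groeneveld–Boel–Kasteleyn).** Let $G=(V,E)$ be a finite connected simple graph embedded in the plane (vertices are distinct points; edges are simple arcs between their endpoints whose interiors are disjoint from each other and from the vertices). For real coupling constants $J=(J_e)_{e\in E}$ and $U=(U_e)_{e\in E}$, the Ashkin–Teller model with free boundary conditions is the probability measure on pairs $(\sigma,\tilde\sigma)\in\{-1,1\}^V\times\{-1,1\}^V$ given by \[ \mathbf P(\sigma,\tilde\sigma)=\frac1{\mathcal Z}\prod_{uv\in E}\exp\big(J_{uv}(\sigma_u\sigma_v+\tilde\sigma_u\tilde\sigma_v)+U_{uv}(\sigma_u\sigma_v\tilde\sigma_u\tilde\sigma_v+1)\big), \] with expectation $\langle\cdot\rangle$; for $U=0$ it consists of two independent Ising models with couplings $J$. Let $\mathcal N=(v_1,\dots,v_m)$ be nodes on the outer (unbounded) face of $G$, that is, vertices on its boundary, where a vertex may be repeated (for instance doubled, its two copies then being consecutive), listed in counterclockwise order. This means that there are paths $\gamma_1,\dots,\gamma_m$ and a circle with $G$ in its interior such that $\gamma_i$ starts at $v_i$, runs afterwards inside the outer face and inside the circle, and ends on the circle; such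 that $\gamma_i$ and $\gamma_j$, for $i\ne j$, have no common point except possibly their starting points; and such that the endpoints of $\gamma_1,\dots,\gamma_m$ are distinct and in counterclockwise order on the circle. Let $K$ be the antisymmetric $m\times m$ matrix with $K_{i,j}=\langle\sigma_{v_i}\sigma_{v_j}\rangle$ for $i<j$, $K_{i,j}=-\langle\sigma_{v_i}\sigma_{v_j}\rangle$ for $i>j$ and $K_{i,i}=0$. For $S\subseteq\{1,\dots,m\}$ let $K^S$ be its restriction to the rows and columns in $S$, and let \[ \mathrm{pf}(K^S)=\sum_{\pi}(-1)^{\mathrm{xg}(\pi)}\prod_{\{i,j\}\in\pi,\ i<j}K_{i,j} \] be its Pfaffian, where $\pi$ runs over all partitions of $S$ into pairs and $\mathrm{xg}(\pi)$ is the number of crossings of $\pi$, i.e. of couples of pairs $\{a,c\},\{b,d\}\in\pi$ with $a<b<c<d$. If $U=0$ and $J\in\mathbb R^E$ is arbitrary, then for every $S\subseteq\{1,\dots,m\}$ of even cardinality, \[ \Big\langle\prod_{i\in S}\sigma_{v_i}\Big\rangle=\mathrm{pf}(K^S). \] -/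

import Mathlib

noncomputable section

namespace AshkinTeller

variable {V : Type*} [Fintype V] [DecidableEq V]

/-- The real value `±1` of the spin at `v`. -/
def spin (σ : V → ℤˣ) (v : V) : ℝ := ((σ v : ℤ) : ℝ)

/-- The product `σ_u σ_v` over the two endpoints of `e = uv`. -/
def edgeSpin (σ : V → ℤˣ) (e : Sym2 V) : ℝ :=
  Sym2.lift ⟨fun u v => spin σ u * spin σ v, fun _ _ => mul_comm _ _⟩ e

/-- The Boltzmann weight of a pair of spin configurations, with free boundary conditions. -/
def weight (G : SimpleGraph V) [DecidableRel G.Adj] (J U : Sym2 V → ℝ) (σ τ : V → ℤˣ) : ℝ :=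
  ∏ e ∈ G.edgeFinset,
    Real.exp (J e * (edgeSpin σ e + edgeSpin τ e) + U e * (edgeSpin σ e * edgeSpin τ e + 1))

def partitionFunction (G : SimpleGraph V) [DecidableRel G.Adj] (J U : Sym2 V → ℝ) : ℝ :=
  ∑ σ : V → ℤˣ, ∑ τ : V → ℤˣ, weight G J U σ τ

/-- The probability `P(σ, τ)` of a pair of spin configurations. -/
def prob (G : SimpleGraph V) [DecidableRel G.Adj] (J U : Sym2 V → ℝ) (σ τ : V → ℤˣ) : ℝ :=
  weight G J U σ τ / partitionFunction G J U

/-- The expectation `⟨f(σ, τ)⟩`. -/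
def expect (G : SimpleGraph V) [DecidableRel G.Adj] (J U : Sym2 V → ℝ)
    (f : (V → ℤˣ) → (V → ℤˣ) → ℝ) : ℝ :=
  ∑ σ : V → ℤˣ, ∑ τ : V → ℤˣ, f σ τ * prob G J U σ τ

/-- `⟨σ_S⟩` for a set `S` of nodes, where the node `i` is projected onto the vertex `v i`. -/
def corr (G : SimpleGraph V) [DecidableRel G.Adj] (J U : Sym2 V → ℝ) {m : ℕ} (v : Fin m → V)
    (S : Finset (Fin m)) : ℝ :=
  expect G J U fun σ _ => ∏ i ∈ S, spin σ (v i)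

/-- The antisymmetric matrix of two-point functions: `⟨σ_i σ_j⟩` above the diagonal. -/
def kernelMatrix (G : SimpleGraph V) [DecidableRel G.Adj] (J U : Sym2 V → ℝ) {m : ℕ}
    (v : Fin m → V) : Matrix (Fin m) (Fin m) ℝ :=
  Matrix.of fun i j =>
    if i = j then 0
    else (if j < i then -1 else 1) * expect G J U fun σ _ => spin σ (v i) * spin σ (v j)

end AshkinTeller

namespace Pfaffian

variable {ι : Type*} [Fintype ι] [LinearOrder ι]

/-- Pairings of `ι`, as fixed-point-free involutions (`π i` is the partner of `i`). -/
def pairings (ι : Type*) [Fintype ι] [LinearOrder ι] : Finset (Equiv.Perm ι) :=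
  Finset.univ.filter fun π => ∀ i, π i ≠ i ∧ π (π i) = i

/-- The number of crossings: pairs of chords `{i, π i}`, `{j, π j}` with `i < j < π i < π j`. -/
def crossings (π : Equiv.Perm ι) : ℕ :=
  (Finset.univ.filter fun p : ι × ι => p.1 < p.2 ∧ p.2 < π p.1 ∧ π p.1 < π p.2).card

/-- The Pfaffian, as the signed sum over pairings. -/
def pf {R : Type*} [CommRing R] (A : Matrix ι ι R) : R :=
  ∑ π ∈ pairings ι, (-1) ^ crossings π * ∏ i ∈ Finset.univ.filter (fun i => i < π i), A i (π i)

end Pfaffian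

/-- An embedding of a graph in the plane: vertices are distinct points, edges are simple arcs
between their endpoints, whose interiors avoid the vertices and all other edges. -/
structure PlaneEmbedding {V : Type*} (G : SimpleGraph V) where
  point : V → ℂ
  point_injective : Function.Injective point
  edge : ∀ ⦃u v : V⦄, G.Adj u v → Path (point u) (point v)
  edge_symm : ∀ ⦃u v : V⦄ (h : G.Adj u v), edge h.symm = (edge h).symm
  edge_injective : ∀ ⦃u v : V⦄ (h : G.Adj u v), Function.Injective (edge h)
  edge_point : ∀ ⦃u v : V⦄ (h : G.Adj u v) (t : unitInterval) (w : V),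
    edge h t = point w → t = 0 ∨ t = 1
  edge_edge : ∀ ⦃u v : V⦄ (h : G.Adj u v) ⦃x y : V⦄ (k : G.Adj x y) (s t : unitInterval),
    s(u, v) ≠ s(x, y) → edge h s = edge k t → edge h s ∈ Set.range point

namespace PlaneEmbedding

variable {V : Type*} {G : SimpleGraph V}

/-- The subset of the plane covered by the embedded graph. -/
def support (E : PlaneEmbedding G) : Set ℂ :=
  Set.range E.point ∪ {z | ∃ (u v : V) (h : G.Adj u v), z ∈ Set.range (E.edge h)}

/-- The outer face: the unbounded connected component of the complement. -/
def outerFace (E : PlaneEmbedding G) : Set ℂ :=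
  {z | z ∈ E.supportᶜ ∧ ¬ Bornology.IsBounded (connectedComponentIn E.supportᶜ z)}

/-- `v 0, …, v (m-1)` are nodes on the outer face, listed counterclockwise. The place of a node on
the boundary of the outer face is recorded by a path that leaves `v i` through the outer face and
ends on a circle around the graph; the paths meet at most in a common starting point, and their
endpoints on the circle come in counterclockwise order. A vertex may occur repeatedly: then it
carries several nodes (a doubled vertex carries two consecutive ones). -/
def IsCounterclockwise (E : PlaneEmbedding G) {m : ℕ} (v : Fin m → V) : Prop :=
  ∃ (R : ℝ) (θ : Fin m → ℝ)
    (γ : ∀ i, Path (E.point (v i)) ((R : ℂ) * Complex.exp ((θ i : ℂ) * Complex.I))),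
    E.support ⊆ Metric.ball 0 R ∧
    StrictMono θ ∧ (∀ i j, θ j < θ i + 2 * Real.pi) ∧
    (∀ i (t : unitInterval), 0 < t → γ i t ∈ E.outerFace) ∧
    (∀ i (t : unitInterval), t < 1 → γ i t ∈ Metric.ball 0 R) ∧
    (∀ i j, i ≠ j → ∀ s t : unitInterval, 0 < s → 0 < t → γ i s ≠ γ j t)

end PlaneEmbedding

end

/-! The Pfaffian can be expanded along the row of the least index `a` of `S`
(`Pfaffian.sum_pairingTerm_eq`), so by induction on `S` it suffices that correlations obey the same
recursion. Cleared of denominators, it is a quadratic identity between Ising sums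
(`isingSum_one_mul_isingSum_nodeSpin`).

The switching identity `isingSum_mul_isingSum` turns a product of Ising sums of `f` and `g` into a
sum over edge sets `F` of two factors. The first depends only on `f * g`, which is the product of
all spins in `S` for every term of the recursion. The second involves only spins constant on the
clusters of `F`, so for `g = σ_a σ_j` it tests whether `a` and `j` share a cluster
(`edgeSum_spin_mul_spin`). Flipping one cluster shows that the first factor vanishes unless every
cluster carries an even number of nodes of `S`.

It remains to see, for each such `F`, that the signs of the `j` in the cluster of `a` add up to 1.
By planarity clusters do not cross (`IsCounterclockwise.reachable_of_lt`), so the nodes between `a`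
and `j` outside the cluster of `a` form whole clusters and are even in number. Hence the signs
alternate over an odd number of `j`, starting with `+`. The weights of the sets `F` may have any
sign, which is why `J` is arbitrary. -/

section

/-! ### Winding of the argument and crossing paths in a disc. -/

open unitInterval

/-- A nowhere vanishing continuous function on the unit square has a continuous logarithm. -/
theorem exists_continuous_log_unitSquare (F : I × I → ℂ) (hF : Continuous F) (h0 : ∀ p, F p ≠ 0) :
    ∃ L : I × I → ℂ, Continuous L ∧ ∀ p, Complex.exp (L p) = F p := by
  -- Clamping the coordinates extends `F` to the simply connected plane, where it lifts through the
  -- covering `exp`.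
  let π : ℝ × ℝ → I × I := fun p =>
    (Set.projIcc 0 1 zero_le_one p.1, Set.projIcc 0 1 zero_le_one p.2)
  have hπ : Continuous π :=
    (continuous_projIcc.comp continuous_fst).prodMk (continuous_projIcc.comp continuous_snd)
  have : LocallyPathConnectedSpace (ℝ × ℝ) := inferInstance
  have : SimplyConnectedSpace (ℝ × ℝ) := inferInstance
  obtain ⟨L, ⟨-, hL⟩, -⟩ := Complex.isCoveringMapOn_exp.existsUnique_continuousMap_lifts
    (⟨F ∘ π, hF.comp hπ⟩ : C(ℝ × ℝ, ℂ)) (a₀ := 0) (Complex.exp_log (h0 (π 0)))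
    (fun p => h0 (π p))
  refine ⟨fun p => L (p.1, p.2), by fun_prop, fun p => ?_⟩
  have := congrFun hL ((p.1 : ℝ), (p.2 : ℝ))
  simpa [π] using this

/-- Polar form: `1 - e^{iφ} = 2 sin(φ/2) e^{i(φ-π)/2}`, with positive modulus and angle within
`(-π/2, π/2)`. -/
theorem Complex.arg_one_sub_exp_mul_I {φ : ℝ} (h0 : 0 < φ) (h1 : φ < 2 * Real.pi) :
    (1 - Complex.exp (φ * Complex.I)).arg = (φ - Real.pi) / 2 := by
  have hs : 0 < 2 * Real.sin (φ / 2) := by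
    have := Real.sin_pos_of_pos_of_lt_pi (x := φ / 2) (by linarith) (by linarith)
    linarith
  have key : 1 - Complex.exp (φ * Complex.I) = ((2 * Real.sin (φ / 2) : ℝ) : ℂ) *
      (Complex.cos (((φ - Real.pi) / 2 : ℝ) : ℂ) +
        Complex.sin (((φ - Real.pi) / 2 : ℝ) : ℂ) * Complex.I) := by
    rw [← Complex.ofReal_cos, ← Complex.ofReal_sin,
      show (φ - Real.pi) / 2 = φ / 2 - Real.pi / 2 by ring, Real.cos_sub_pi_div_two,
      Real.sin_sub_pi_div_two, Complex.exp_mul_I, ← Complex.ofReal_cos, ← Complex.ofReal_sin]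
    have h2 : Real.cos φ = 1 - 2 * Real.sin (φ / 2) ^ 2 := by
      conv_lhs => rw [show φ = 2 * (φ / 2) by ring, Real.cos_two_mul]
      linear_combination 2 * Real.cos_sq_add_sin_sq (φ / 2)
    have h3 : Real.sin φ = 2 * Real.sin (φ / 2) * Real.cos (φ / 2) := by
      conv_lhs => rw [show φ = 2 * (φ / 2) by ring, Real.sin_two_mul]
    rw [h2, h3]
    push_cast
    ring
  rw [key, Complex.arg_mul_cos_add_sin_mul_I hs]
  constructor <;> linarith [Real.pi_pos]

theorem Complex.re_one_sub_pos {w : ℂ} (h : ‖w‖ ≤ 1) (h1 : w ≠ 1) : 0 < (1 - w).re := by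
  have hn : w.re ^ 2 + w.im ^ 2 ≤ 1 := by
    have := Complex.sq_norm w
    rw [Complex.normSq_apply] at this
    nlinarith [norm_nonneg w]
  rw [Complex.sub_re, Complex.one_re]
  by_contra! hc
  have him : w.im = 0 := by nlinarith [sq_nonneg w.im]
  have hre : w.re = 1 := by nlinarith [sq_nonneg w.im]
  exact h1 (Complex.ext (by simpa using hre) (by simpa using him))

/-- The variation of the argument of `R e^{iθ} - g t` along a path `g` in the disc. -/
theorem im_log_circle_sub {R θ φ ψ : ℝ} (hR : 0 < R) (hφ : θ < φ) (hφ' : φ < θ + 2 * Real.pi)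
    (hψ : θ < ψ) (hψ' : ψ < θ + 2 * Real.pi) (g L : I → ℂ) (hg : Continuous g)
    (hL : Continuous L) (hgR : ∀ t, ‖g t‖ ≤ R)
    (hexp : ∀ t, Complex.exp (L t) = R * Complex.exp (θ * Complex.I) - g t)
    (h0 : g 0 = R * Complex.exp (φ * Complex.I)) (h1 : g 1 = R * Complex.exp (ψ * Complex.I)) :
    (L 1 - L 0).im = (ψ - φ) / 2 := by
  have hR' : (R : ℂ) ≠ 0 := by exact_mod_cast hR.ne'
  set p : ℂ := R * Complex.exp (θ * Complex.I) with hp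
  have hp0 : p ≠ 0 := mul_ne_zero hR' (Complex.exp_ne_zero _)
  have hpn : ‖p‖ = R := by
    rw [hp, norm_mul, Complex.norm_exp_ofReal_mul_I, mul_one, Complex.norm_real,
      Real.norm_of_nonneg hR.le]
  -- Seen from the boundary point `p` the disc lies in a half-plane, so after division by `p` the
  -- principal logarithm is continuous along `g` and differs from `L` by a constant.
  have hz : ∀ t, 0 < (1 - g t / p).re := fun t => by
    apply Complex.re_one_sub_pos
    · rw [norm_div, hpn]
      exact (div_le_one hR).2 (hgR t)
    · intro h
      have : g t = p := by field_simp at h; exact h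
      exact Complex.exp_ne_zero (L t) (by rw [hexp, this, sub_self])
  have hlog : Continuous fun t => Complex.log (1 - g t / p) := by
    refine Continuous.clog (by fun_prop) fun t => Or.inl (hz t)
  have hconst := Complex.isCoveringMap_exp.const_of_comp
    (g := fun t => L t - Complex.log (1 - g t / p)) (hL.sub hlog) (fun a b => by
      have : ∀ t, Complex.exp (L t - Complex.log (1 - g t / p)) = p := fun t => by
        have hne : 1 - g t / p ≠ 0 := fun h => by simpa [h] using hz t
        rw [Complex.exp_sub, Complex.exp_log hne, hexp, div_eq_iff hne]
        field_simp
      exact Subtype.ext ((this a).trans (this b).symm)) 1 0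
  have hq : ∀ α : ℝ, (R : ℂ) * Complex.exp (α * Complex.I) / p
      = Complex.exp (((α - θ : ℝ) : ℂ) * Complex.I) := fun α => by
    rw [hp, mul_div_mul_left _ _ hR', ← Complex.exp_sub]
    congr 1; push_cast; ring
  have e : L 1 - L 0 = Complex.log (1 - g 1 / p) - Complex.log (1 - g 0 / p) := by
    linear_combination hconst
  rw [e, h0, h1, hq, hq, Complex.sub_im, Complex.log_im, Complex.log_im,
    Complex.arg_one_sub_exp_mul_I (by linarith) (by linarith),
    Complex.arg_one_sub_exp_mul_I (by linarith) (by linarith)]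
  ring

/-- Two paths in a closed disc whose endpoints alternate on the boundary circle meet. -/
theorem exists_eq_of_alternating_endpoints {R a b c d : ℝ} (hR : 0 < R) (hab : a < b) (hbc : b < c)
    (hcd : c < d) (hda : d < a + 2 * Real.pi)
    (f : Path ((R : ℂ) * Complex.exp (a * Complex.I)) (R * Complex.exp (c * Complex.I)))
    (g : Path ((R : ℂ) * Complex.exp (b * Complex.I)) (R * Complex.exp (d * Complex.I)))
    (hf : ∀ t, ‖f t‖ ≤ R) (hg : ∀ t, ‖g t‖ ≤ R) : ∃ s t, f s = g t := by
  by_contra! hne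
  obtain ⟨L, hL, hexp⟩ := exists_continuous_log_unitSquare (fun p => f p.1 - g p.2) (by fun_prop)
    fun p => sub_ne_zero.2 (hne _ _)
  have hper : ∀ x : ℝ, Complex.exp (((x + 2 * Real.pi : ℝ) : ℂ) * Complex.I)
      = Complex.exp (x * Complex.I) := fun x => by
    push_cast
    rw [add_mul, Complex.exp_add, Complex.exp_two_pi_mul_I, mul_one]
  have hneg : ∀ z, Complex.exp (z + Real.pi * Complex.I) = - Complex.exp z := fun z => by
    rw [Complex.exp_add, Complex.exp_pi_mul_I]; ring
  -- The variation of the argument of `f s - g t` is computed on each side of the square. The `2π`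
  -- shifts move the angles into `(θ, θ + 2π)`; adding `πi` to `L` replaces `f - g` by `g - f` on
  -- the sides where `g` is fixed.
  have left := im_log_circle_sub (θ := a) (φ := b) (ψ := d) hR (by linarith) (by linarith)
    (by linarith) (by linarith) g (fun t => L (0, t)) (by fun_prop) (by fun_prop) hg
    (fun t => by simp [hexp]) (by simp) (by simp)
  have right := im_log_circle_sub (θ := c) (φ := b + 2 * Real.pi) (ψ := d) hR (by linarith)
    (by linarith) (by linarith) (by linarith) g (fun t => L (1, t)) (by fun_prop) (by fun_prop) hg
    (fun t => by simp [hexp]) (by rw [hper]; simp) (by simp)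
  have bot := im_log_circle_sub (θ := b) (φ := a + 2 * Real.pi) (ψ := c) hR (by linarith)
    (by linarith) (by linarith) (by linarith) f (fun t => L (t, 0) + Real.pi * Complex.I)
    (by fun_prop) (by fun_prop) hf
    (fun t => by rw [hneg, hexp]; simp) (by rw [hper]; simp) (by simp)
  have top := im_log_circle_sub (θ := d) (φ := a + 2 * Real.pi) (ψ := c + 2 * Real.pi) hR
    (by linarith) (by linarith) (by linarith) (by linarith) f
    (fun t => L (t, 1) + Real.pi * Complex.I) (by fun_prop) (by fun_prop) hf
    (fun t => by rw [hneg, hexp]; simp) (by rw [hper]; simp) (by rw [hper]; simp)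
  simp only [Complex.sub_im, Complex.add_im] at left right bot top
  -- The four variations add up to `2π` around the square, whereas those of a single-valued `L`
  -- cancel.
  linarith [Real.pi_pos]

/-! ### Clusters of a plane graph do not cross. -/

namespace PlaneEmbedding

variable {V : Type*} {G : SimpleGraph V}

/-- The part of the plane covered by the connected component of `x` in a subgraph `H`. -/
def cluster (E : PlaneEmbedding G) (H : SimpleGraph V) (x : V) : Set ℂ :=
  {z | ∃ u, H.Reachable x u ∧
    (z = E.point u ∨ ∃ (w : V) (h : G.Adj u w), H.Adj u w ∧ z ∈ Set.range (E.edge h))}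

theorem cluster_subset_support (E : PlaneEmbedding G) (H : SimpleGraph V) (x : V) :
    E.cluster H x ⊆ E.support := by
  rintro z ⟨u, -, rfl | ⟨w, h, -, hz⟩⟩
  · exact Or.inl ⟨u, rfl⟩
  · exact Or.inr ⟨u, w, h, hz⟩

theorem point_mem_cluster (E : PlaneEmbedding G) {H : SimpleGraph V} {x u : V}
    (h : H.Reachable x u) : E.point u ∈ E.cluster H x :=
  ⟨u, h, Or.inl rfl⟩

theorem joinedIn_cluster (E : PlaneEmbedding G) {H : SimpleGraph V} (hH : H ≤ G) {x y : V}
    (h : H.Reachable x y) : JoinedIn (E.cluster H x) (E.point x) (E.point y) := by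
  obtain ⟨p⟩ := h
  suffices key : ∀ {u w : V}, H.Walk u w → H.Reachable x u →
      JoinedIn (E.cluster H x) (E.point u) (E.point w) from key p (SimpleGraph.Reachable.refl x)
  intro u w q
  induction q with
  | nil => exact fun hu => JoinedIn.refl (E.point_mem_cluster hu)
  | @cons u s w hus _ ih =>
    intro hu
    refine JoinedIn.trans ⟨E.edge (hH hus), fun t => ?_⟩ (ih (hu.trans hus.reachable))
    exact ⟨u, hu, Or.inr ⟨s, hH hus, hus, t, rfl⟩⟩

theorem eq_or_eq_of_edge_eq_point (E : PlaneEmbedding G) {u w x : V} (h : G.Adj u w) {t : I}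
    (ht : E.edge h t = E.point x) : x = u ∨ x = w := by
  rcases E.edge_point h t x ht with rfl | rfl
  · rw [Path.source] at ht
    exact Or.inl (E.point_injective ht).symm
  · rw [Path.target] at ht
    exact Or.inr (E.point_injective ht).symm

/-- A vertex on the embedded cluster of `x` belongs to the cluster of `x`. -/
theorem reachable_of_point_mem_cluster (E : PlaneEmbedding G) {H : SimpleGraph V} {x w : V}
    (h : E.point w ∈ E.cluster H x) : H.Reachable x w := by
  obtain ⟨u, hu, h | ⟨y, hG, hH, t, ht⟩⟩ := h
  · rwa [E.point_injective h]
  · rcases E.eq_or_eq_of_edge_eq_point hG ht with rfl | rfl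
    · exact hu
    · exact hu.trans hH.reachable

theorem reachable_of_mem_cluster (E : PlaneEmbedding G) {H : SimpleGraph V} {x y : V} {z : ℂ}
    (hx : z ∈ E.cluster H x) (hy : z ∈ E.cluster H y) : H.Reachable x y := by
  have key : z ∈ Set.range E.point → H.Reachable x y := by
    rintro ⟨w, rfl⟩
    exact (E.reachable_of_point_mem_cluster hx).trans (E.reachable_of_point_mem_cluster hy).symm
  obtain ⟨u, hu, h | ⟨u', hG, hH, s, hs⟩⟩ := id hx
  · exact key ⟨u, h.symm⟩
  obtain ⟨w, hw, h | ⟨w', kG, kH, t, ht⟩⟩ := id hy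
  · exact key ⟨w, h.symm⟩
  -- A common point lies on the same edge, possibly read in opposite directions, or on two distinct
  -- edges, which meet only in vertices.
  by_cases hne : s(u, u') = s(w, w')
  · rcases Sym2.eq_iff.1 hne with ⟨rfl, rfl⟩ | ⟨rfl, rfl⟩
    · exact hu.trans hw.symm
    · exact hu.trans (hH.reachable.trans hw.symm)
  · exact key (hs ▸ E.edge_edge hG kG s t hne (hs.trans ht.symm))

/-- In a subgraph of a plane graph, clusters of nodes on the outer face do not cross. -/
theorem IsCounterclockwise.reachable_of_lt {E : PlaneEmbedding G} {m : ℕ} {v : Fin m → V}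
    (hv : E.IsCounterclockwise v) {H : SimpleGraph V} (hH : H ≤ G) {i j k l : Fin m}
    (hij : i < j) (hjk : j < k) (hkl : k < l) (hik : H.Reachable (v i) (v k))
    (hjl : H.Reachable (v j) (v l)) : H.Reachable (v i) (v j) := by
  obtain ⟨R, θ, γ, hsupp, hθ, hθ', hout, hball, hdisj⟩ := hv
  have hsR : ∀ z ∈ E.support, ‖z‖ < R := fun z hz => by simpa using hsupp hz
  have hR : 0 < R := (norm_nonneg _).trans_lt (hsR _ (Or.inl ⟨v i, rfl⟩))
  -- A cluster with the legs joining two of its nodes to the circle. The parameter 0 is left out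
  -- because legs may share their starting point, which lies in the cluster anyway.
  let A : Fin m → Fin m → Set ℂ := fun a b =>
    E.cluster H (v a) ∪ ({z | ∃ t, 0 < t ∧ γ a t = z} ∪ {z | ∃ t, 0 < t ∧ γ b t = z})
  have hγR : ∀ a t, ‖γ a t‖ ≤ R := fun a t => by
    rcases eq_or_lt_of_le (le_one' : t ≤ 1) with rfl | ht
    · rw [Path.target, norm_mul, Complex.norm_exp_ofReal_mul_I, mul_one, Complex.norm_real,
        Real.norm_of_nonneg hR.le]
    · exact le_of_lt (by simpa using hball a t ht)
  have hAR : ∀ a b, ∀ z ∈ A a b, ‖z‖ ≤ R := by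
    rintro a b z (hz | ⟨t, -, rfl⟩ | ⟨t, -, rfl⟩)
    · exact (hsR z (E.cluster_subset_support H _ hz)).le
    · exact hγR a t
    · exact hγR b t
  have hjoin : ∀ a b, H.Reachable (v a) (v b) → JoinedIn (A a b)
      ((R : ℂ) * Complex.exp ((θ a : ℂ) * Complex.I))
      ((R : ℂ) * Complex.exp ((θ b : ℂ) * Complex.I)) := fun a b hab => by
    have hleg : ∀ c, H.Reachable (v a) (v c) → (∀ t, 0 < t → γ c t ∈ A a b) →
        JoinedIn (A a b) (E.point (v c)) ((R : ℂ) * Complex.exp ((θ c : ℂ) * Complex.I)) :=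
      fun c hc h => ⟨γ c, fun t => by
        rcases eq_or_lt_of_le (nonneg' : 0 ≤ t) with rfl | ht
        · rw [Path.source]
          exact Or.inl (E.point_mem_cluster hc)
        · exact h t ht⟩
    exact ((hleg a (.refl _) fun t ht => Or.inr (Or.inl ⟨t, ht, rfl⟩)).symm.trans
      ((E.joinedIn_cluster hH hab).mono Set.subset_union_left)).trans
      (hleg b hab fun t ht => Or.inr (Or.inr ⟨t, ht, rfl⟩))
  have hf := hjoin i k hik
  have hg := hjoin j l hjl
  obtain ⟨s, t, hst⟩ := exists_eq_of_alternating_endpoints hR (hθ hij) (hθ hjk) (hθ hkl) (hθ' i l)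
    hf.somePath hg.somePath (fun t => hAR _ _ _ (hf.somePath_mem t))
    (fun t => hAR _ _ _ (hg.somePath_mem t))
  have hz := hf.somePath_mem s
  have hz' := hg.somePath_mem t
  rw [← hst] at hz'
  generalize hf.somePath s = z at hz hz'
  have hno : ∀ a b t, 0 < t → γ a t ∉ E.cluster H (v b) := fun a b t ht h =>
    (hout a t ht).1 (E.cluster_subset_support H _ h)
  have hno' : ∀ a b, a ≠ b → ∀ s t, 0 < s → 0 < t → γ b t = γ a s → False :=
    fun a b hab s t hs ht h => hdisj a b hab s t hs ht h.symm
  -- For positive parameter the legs avoid the support, and legs of distinct nodes are disjoint;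
  -- only a point common to both clusters is possible.
  rcases hz with hz | ⟨s, hs, rfl⟩ | ⟨s, hs, rfl⟩ <;> rcases hz' with hz' | ⟨t, ht, h⟩ | ⟨t, ht, h⟩
  · exact E.reachable_of_mem_cluster hz hz'
  · exact absurd (h ▸ hz) (hno _ _ t ht)
  · exact absurd (h ▸ hz) (hno _ _ t ht)
  · exact absurd hz' (hno _ _ s hs)
  · exact (hno' _ _ hij.ne s t hs ht h).elim
  · exact (hno' _ _ (hij.trans (hjk.trans hkl)).ne s t hs ht h).elim
  · exact absurd hz' (hno _ _ s hs)
  · exact (hno' _ _ hjk.ne' s t hs ht h).elim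
  · exact (hno' _ _ hkl.ne s t hs ht h).elim

end PlaneEmbedding

end

/-! ### Parity and alternating signs in noncrossing partitions. -/

theorem Finset.sum_neg_one_pow_card_filter_lt {ι : Type*} [LinearOrder ι] (T : Finset ι) :
    ∑ j ∈ T, (-1 : ℝ) ^ (T.filter (· < j)).card = if Odd T.card then 1 else 0 := by
  induction T using Finset.induction_on_max with
  | empty => simp
  | insert a T hT ih =>
    have ha : a ∉ T := fun h => lt_irrefl a (hT a h)
    have h1 : (insert a T).filter (· < a) = T := by
      rw [Finset.filter_insert, if_neg (lt_irrefl a), Finset.filter_true_of_mem hT]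
    have h2 : ∀ j ∈ T, (-1 : ℝ) ^ ((insert a T).filter (· < j)).card
        = (-1) ^ (T.filter (· < j)).card := fun j hj => by
      rw [Finset.filter_insert, if_neg (hT j hj).not_gt]
    rw [Finset.sum_insert ha, h1, Finset.sum_congr rfl h2, ih, Finset.card_insert_of_notMem ha]
    by_cases h : Odd T.card
    · simp [Nat.odd_add_one, h, h.neg_one_pow]
    · simp [Nat.odd_add_one, h, (Nat.not_odd_iff_even.1 h).neg_one_pow]

/-- If the classes of an equivalence relation do not cross and each has an even number of points
in `S`, then between two related points there is an even number of unrelated ones. -/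
theorem Finset.even_card_filter_between {ι : Type*} [LinearOrder ι] (r : Setoid ι)
    [DecidableRel r] (S : Finset ι) (hr : ∀ i j k l, i < j → j < k → k < l → r i k → r j l → r i j)
    (heven : ∀ i, Even (S.filter (r i ·)).card) {a : ι} (hmin : ∀ i ∈ S, a ≤ i)
    {j : ι} (haj : r a j) :
    Even (S.filter fun i => (a < i ∧ i < j) ∧ ¬ r a i).card := by
  classical
  -- The count is made class by class: a class other than that of `a` with a point between `a` and
  -- `j` cannot leave this interval without crossing the class of `a`, so it is counted in full.
  rw [Finset.card_eq_sum_card_image (fun i => (Quotient.mk r i))]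
  refine Finset.even_sum _ fun q hq => ?_
  obtain ⟨x, hx, rfl⟩ := Finset.mem_image.1 hq
  obtain ⟨-, ⟨hax, hxj⟩, hnx⟩ := Finset.mem_filter.1 hx
  refine (congrArg (fun X : Finset ι => Even X.card) ?_).mpr (heven x)
  ext i
  simp only [Finset.mem_filter, Quotient.eq]
  constructor
  · rintro ⟨⟨hi, -⟩, hix⟩
    exact ⟨hi, r.symm hix⟩
  · rintro ⟨hi, hxi⟩
    have hai : ¬ r a i := fun h => hnx (r.trans h (r.symm hxi))
    have hia : a < i := lt_of_le_of_ne (hmin i hi) fun h => hai (h ▸ r.refl a)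
    refine ⟨⟨hi, ⟨hia, ?_⟩, hai⟩, r.symm hxi⟩
    rcases lt_trichotomy i j with h | rfl | h
    · exact h
    · exact absurd haj hai
    · exact absurd (hr a x j i hax hxj h haj hxi) hnx

/-- Unrelated points in between come in even number and do not affect the sign, so the signs
alternate along the class of `a`. Without `a` this class has odd size, and `1 - 1 + ... + 1 = 1`. -/
theorem Finset.sum_neg_one_pow_between_related {ι : Type*} [LinearOrder ι] (r : Setoid ι)
    [DecidableRel r] (S : Finset ι) (hr : ∀ i j k l, i < j → j < k → k < l → r i k → r j l → r i j)
    (heven : ∀ i, Even (S.filter (r i ·)).card) {a : ι} (ha : a ∈ S) (hmin : ∀ i ∈ S, a ≤ i) :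
    ∑ j ∈ (S.erase a).filter (r a ·), (-1 : ℝ) ^ (S.filter fun i => a < i ∧ i < j).card = 1 := by
  set T := (S.erase a).filter (r a ·) with hT
  have hodd : Odd T.card := by
    have h : S.filter (r a ·) = insert a T := by
      rw [hT, Finset.filter_erase, Finset.insert_erase]
      exact Finset.mem_filter.2 ⟨ha, r.refl a⟩
    have h2 := heven a
    rw [h, Finset.card_insert_of_notMem (by simp [hT]), Nat.even_add_one,
      Nat.not_even_iff_odd] at h2
    exact h2
  have hsign : ∀ j ∈ T, (-1 : ℝ) ^ (S.filter fun i => a < i ∧ i < j).card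
      = (-1) ^ (T.filter (· < j)).card := fun j hj => by
    have haj : r a j := (Finset.mem_filter.1 hj).2
    have hsplit := Finset.card_filter_add_card_filter_not
      (s := S.filter fun i => a < i ∧ i < j) (r a ·)
    rw [Finset.filter_filter, Finset.filter_filter] at hsplit
    have hTj : (S.filter fun i => (a < i ∧ i < j) ∧ r a i) = T.filter (· < j) := by
      ext i
      simp only [hT, Finset.mem_filter, Finset.mem_erase]
      constructor
      · rintro ⟨hi, ⟨hai, hij⟩, h⟩
        exact ⟨⟨⟨hai.ne', hi⟩, h⟩, hij⟩
      · rintro ⟨⟨⟨hai, hi⟩, h⟩, hij⟩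
        exact ⟨hi, ⟨lt_of_le_of_ne (hmin i hi) (Ne.symm hai), hij⟩, h⟩
    rw [← hsplit, hTj, pow_add,
      (Finset.even_card_filter_between r S hr heven hmin haj).neg_one_pow, mul_one]
  rw [Finset.sum_congr rfl hsign, Finset.sum_neg_one_pow_card_filter_lt, if_pos hodd]

/-! ### The switching identity and cluster flips for Ising sums. -/

noncomputable section

namespace AshkinTeller

variable {V : Type*}

theorem spin_mul (σ τ : V → ℤˣ) (x : V) : spin (σ * τ) x = spin σ x * spin τ x := by
  simp [spin]

theorem spin_mul_self (σ : V → ℤˣ) (x : V) : spin σ x * spin σ x = 1 := by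
  unfold spin
  rcases Int.units_eq_one_or (σ x) with h | h <;> simp [h]

theorem edgeSpin_mk (σ : V → ℤˣ) (x y : V) : edgeSpin σ s(x, y) = spin σ x * spin σ y := rfl

theorem edgeSpin_mul (σ τ : V → ℤˣ) (e : Sym2 V) :
    edgeSpin (σ * τ) e = edgeSpin σ e * edgeSpin τ e := by
  induction e with
  | h x y => rw [edgeSpin_mk, edgeSpin_mk, edgeSpin_mk, spin_mul, spin_mul]; ring

theorem edgeSpin_eq_or (σ : V → ℤˣ) (e : Sym2 V) : edgeSpin σ e = 1 ∨ edgeSpin σ e = -1 := by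
  induction e with
  | h x y =>
    rw [edgeSpin_mk]
    unfold spin
    rcases Int.units_eq_one_or (σ x) with h | h <;>
      rcases Int.units_eq_one_or (σ y) with h' | h' <;> simp [h, h']

/-- The product of the spins of the nodes in `S`. -/
def nodeSpin {m : ℕ} (v : Fin m → V) (S : Finset (Fin m)) (σ : V → ℤˣ) : ℝ :=
  ∏ i ∈ S, spin σ (v i)

theorem nodeSpin_mul {m : ℕ} (v : Fin m → V) (S : Finset (Fin m)) (σ τ : V → ℤˣ) :
    nodeSpin v S (σ * τ) = nodeSpin v S σ * nodeSpin v S τ := by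
  simp only [nodeSpin, spin_mul, Finset.prod_mul_distrib]

variable [Fintype V] [DecidableEq V]

/-- The unnormalized expectation of `f` in the Ising model. -/
def isingSum (G : SimpleGraph V) [DecidableRel G.Adj] (J : Sym2 V → ℝ) (f : (V → ℤˣ) → ℝ) : ℝ :=
  ∑ σ : V → ℤˣ, f σ * ∏ e ∈ G.edgeFinset, Real.exp (J e * edgeSpin σ e)

theorem isingSum_one_pos (G : SimpleGraph V) [DecidableRel G.Adj] (J : Sym2 V → ℝ) :
    0 < isingSum G J fun _ => 1 :=
  Finset.sum_pos (fun σ _ => by positivity) Finset.univ_nonempty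

/-- For `U = 0` the two spin configurations are independent Ising models. -/
theorem expect_eq_isingSum_div (G : SimpleGraph V) [DecidableRel G.Adj] (J U : Sym2 V → ℝ)
    (hU : ∀ e ∈ G.edgeSet, U e = 0) (f : (V → ℤˣ) → ℝ) :
    expect G J U (fun σ _ => f σ) = isingSum G J f / isingSum G J fun _ => 1 := by
  have hw : ∀ σ τ, weight G J U σ τ = (∏ e ∈ G.edgeFinset, Real.exp (J e * edgeSpin σ e)) *
      ∏ e ∈ G.edgeFinset, Real.exp (J e * edgeSpin τ e) := fun σ τ => by
    rw [weight, ← Finset.prod_mul_distrib]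
    refine Finset.prod_congr rfl fun e he => ?_
    rw [hU e (SimpleGraph.mem_edgeFinset.1 he), ← Real.exp_add]
    ring_nf
  have hZ := (isingSum_one_pos G J).ne'
  have hsum : ∀ g : (V → ℤˣ) → ℝ, ∑ σ, ∑ τ, g σ * weight G J U σ τ
      = isingSum G J g * isingSum G J fun _ => 1 := fun g => by
    simp only [hw, isingSum, Finset.sum_mul_sum]
    exact Finset.sum_congr rfl fun σ _ => Finset.sum_congr rfl fun τ _ => by ring
  have hpart : partitionFunction G J U = (isingSum G J fun _ => 1) * isingSum G J fun _ => 1 := by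
    rw [← hsum]
    simp [partitionFunction]
  simp only [expect, prob, ← mul_div_assoc, ← Finset.sum_div]
  rw [hsum, hpart, mul_div_mul_right _ _ hZ]

/-- The sum of `g` over spin configurations with weights attached to the edges in `F`. -/
def edgeSum (F : Finset (Sym2 V)) (h : Sym2 V → ℝ → ℝ) (g : (V → ℤˣ) → ℝ) : ℝ :=
  ∑ σ : V → ℤˣ, g σ * ∏ e ∈ F, h e (edgeSpin σ e)

/-- The switching identity: the product of two Ising expectations as a sum over edge sets, in which
the dependence on the two factors is separated. -/
theorem isingSum_mul_isingSum (G : SimpleGraph V) [DecidableRel G.Adj] (J : Sym2 V → ℝ)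
    (f g : (V → ℤˣ) → ℝ) (hg : ∀ σ τ, g (σ * τ) = g σ * g τ) :
    isingSum G J f * isingSum G J g = ∑ F ∈ G.edgeFinset.powerset,
      edgeSum F (fun e x => Real.exp (2 * J e * x) - 1) (fun σ => f σ * g σ) *
        edgeSum F (fun _ x => (1 + x) / 2) g := by
  -- Once the second configuration is written as `σ * τ`, the two edge weights multiply to `exp (2 J
  -- σ_e)` if `τ_e = 1` and cancel if `τ_e = -1`. Expanding the product of these sums over the edges
  -- yields the sets `F`.
  have hexp : ∀ (σ τ : V → ℤˣ) (e : Sym2 V),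
      Real.exp (J e * edgeSpin σ e) * Real.exp (J e * edgeSpin (σ * τ) e)
        = 1 + (Real.exp (2 * J e * edgeSpin σ e) - 1) * ((1 + edgeSpin τ e) / 2) := by
    intro σ τ e
    rw [edgeSpin_mul, ← Real.exp_add]
    rcases edgeSpin_eq_or τ e with h | h <;> rw [h]
    · ring_nf
    · simp
  calc isingSum G J f * isingSum G J g
      = ∑ σ, ∑ τ, (f σ * ∏ e ∈ G.edgeFinset, Real.exp (J e * edgeSpin σ e)) *
          (g τ * ∏ e ∈ G.edgeFinset, Real.exp (J e * edgeSpin τ e)) := by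
        rw [isingSum, isingSum, Finset.sum_mul_sum]
    _ = ∑ σ, ∑ τ, (f σ * ∏ e ∈ G.edgeFinset, Real.exp (J e * edgeSpin σ e)) *
          (g (σ * τ) * ∏ e ∈ G.edgeFinset, Real.exp (J e * edgeSpin (σ * τ) e)) :=
        Finset.sum_congr rfl fun σ _ => (Equiv.sum_comp (Equiv.mulLeft σ) _).symm
    _ = ∑ σ, ∑ τ, ∑ F ∈ G.edgeFinset.powerset,
          (f σ * g σ * ∏ e ∈ F, (Real.exp (2 * J e * edgeSpin σ e) - 1)) *
            (g τ * ∏ e ∈ F, (1 + edgeSpin τ e) / 2) := by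
        refine Finset.sum_congr rfl fun σ _ => Finset.sum_congr rfl fun τ _ => ?_
        calc _ = f σ * g σ * g τ * ∏ e ∈ G.edgeFinset,
              (Real.exp (J e * edgeSpin σ e) * Real.exp (J e * edgeSpin (σ * τ) e)) := by
              rw [hg, Finset.prod_mul_distrib]; ring
          _ = _ := by
              simp only [hexp]
              rw [Finset.prod_one_add, Finset.mul_sum]
              refine Finset.sum_congr rfl fun F _ => ?_
              rw [Finset.prod_mul_distrib]; ring
    _ = _ := by
        simp only [edgeSum, Finset.sum_mul_sum]
        rw [Finset.sum_comm]
        rw [Finset.sum_congr rfl fun σ _ => Finset.sum_comm, Finset.sum_comm]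
        exact Finset.sum_congr rfl fun F _ => Finset.sum_comm

/-- A sum over spin configurations vanishes if its observable changes sign when the spins are
flipped by some `κ` that is constant along the edges in `F`. -/
theorem edgeSum_eq_zero_of_flip (F : Finset (Sym2 V)) (h : Sym2 V → ℝ → ℝ) (g : (V → ℤˣ) → ℝ)
    (hg : ∀ σ τ, g (σ * τ) = g σ * g τ) (κ : V → ℤˣ) (hκ : ∀ e ∈ F, edgeSpin κ e = 1)
    (hgκ : g κ = -1) : edgeSum F h g = 0 := by
  have : edgeSum F h g = -edgeSum F h g := by
    conv_lhs => rw [edgeSum, ← Equiv.sum_comp (Equiv.mulLeft κ)]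
    rw [edgeSum, ← Finset.sum_neg_distrib]
    refine Finset.sum_congr rfl fun σ _ => ?_
    rw [Equiv.coe_mulLeft, hg, hgκ, Finset.prod_congr rfl fun e he => by
      rw [edgeSpin_mul, hκ e he, one_mul]]
    ring
  linarith

open Classical in
/-- The configuration that is `-1` exactly on the cluster of `x`. -/
def clusterFlip (H : SimpleGraph V) (x : V) : V → ℤˣ := fun u => if H.Reachable x u then -1 else 1

theorem spin_clusterFlip_of_reachable {H : SimpleGraph V} {x u : V} (h : H.Reachable x u) :
    spin (clusterFlip H x) u = -1 := by
  simp [spin, clusterFlip, h]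

theorem spin_clusterFlip_of_not_reachable {H : SimpleGraph V} {x u : V} (h : ¬ H.Reachable x u) :
    spin (clusterFlip H x) u = 1 := by
  simp [spin, clusterFlip, h]

theorem edgeSpin_clusterFlip (F : Finset (Sym2 V)) (x : V) {e : Sym2 V} (he : e ∈ F) :
    edgeSpin (clusterFlip (SimpleGraph.fromEdgeSet (F : Set (Sym2 V))) x) e = 1 := by
  induction e with
  | h y z =>
    set H := SimpleGraph.fromEdgeSet (F : Set (Sym2 V))
    rw [edgeSpin_mk]
    have hyz : H.Reachable y z := by
      by_cases h : y = z
      · exact h ▸ SimpleGraph.Reachable.refl y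
      · exact SimpleGraph.Adj.reachable ((SimpleGraph.fromEdgeSet_adj _).2 ⟨he, h⟩)
    by_cases h : H.Reachable x y
    · rw [spin_clusterFlip_of_reachable h, spin_clusterFlip_of_reachable (h.trans hyz)]; ring
    · rw [spin_clusterFlip_of_not_reachable h,
        spin_clusterFlip_of_not_reachable fun h' => h (h'.trans hyz.symm)]
      ring

open Classical in
/-- An edge set contributes only if each of its clusters has an even number of nodes. -/
theorem even_card_of_edgeSum_ne_zero {m : ℕ} (v : Fin m → V) (S : Finset (Fin m))
    (F : Finset (Sym2 V)) (h : Sym2 V → ℝ → ℝ) (hne : edgeSum F h (nodeSpin v S) ≠ 0) (x : V) :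
    Even (S.filter fun i =>
      (SimpleGraph.fromEdgeSet (F : Set (Sym2 V))).Reachable x (v i)).card := by
  by_contra hodd
  rw [Nat.not_even_iff_odd] at hodd
  refine hne (edgeSum_eq_zero_of_flip F h _ (nodeSpin_mul v S)
    (clusterFlip (SimpleGraph.fromEdgeSet (F : Set (Sym2 V))) x)
    (fun e he => edgeSpin_clusterFlip F x he) ?_)
  -- Flipping the cluster of `x` multiplies the node product by `-1` once per node of `S` in it.
  rw [← hodd.neg_one_pow (α := ℝ), ← Finset.prod_const, Finset.prod_filter, nodeSpin]
  refine Finset.prod_congr rfl fun i _ => ?_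
  split_ifs with hi
  · exact spin_clusterFlip_of_reachable hi
  · exact spin_clusterFlip_of_not_reachable hi

-- The factor `(1 + τ_e) / 2` is the indicator that `τ` agrees at both ends of `e`, so only spins
-- constant on clusters survive. On these the observable is 1 if `x` and `y` are joined; otherwise
-- flipping the cluster of `x` cancels the sum.
open Classical in
theorem edgeSum_spin_mul_spin (F : Finset (Sym2 V)) (x y : V) :
    edgeSum F (fun _ z => (1 + z) / 2) (fun τ => spin τ x * spin τ y) =
      if (SimpleGraph.fromEdgeSet (F : Set (Sym2 V))).Reachable x y then
        edgeSum F (fun _ z => (1 + z) / 2) fun _ => 1 else 0 := by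
  split_ifs with hxy
  · refine Finset.sum_congr rfl fun τ _ => ?_
    by_cases hτ : ∀ e ∈ F, edgeSpin τ e = 1
    · congr 1
      obtain ⟨p⟩ := hxy
      induction p with
      | nil => exact spin_mul_self τ _
      | @cons x z y hxz _ ih =>
        have h1 := hτ _ ((SimpleGraph.fromEdgeSet_adj _).1 hxz).1
        rw [edgeSpin_mk] at h1
        linear_combination -(spin τ x * spin τ y) * spin_mul_self τ z +
          (spin τ z * spin τ y) * h1 + ih
    · push Not at hτ
      obtain ⟨e, he, hne⟩ := hτ
      have : ∏ e ∈ F, (1 + edgeSpin τ e) / 2 = 0 :=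
        Finset.prod_eq_zero he (by rw [(edgeSpin_eq_or τ e).resolve_left hne]; norm_num)
      rw [this, mul_zero, mul_zero]
  · refine edgeSum_eq_zero_of_flip F _ _ (fun σ τ => by rw [spin_mul, spin_mul]; ring)
      (clusterFlip (SimpleGraph.fromEdgeSet (F : Set (Sym2 V))) x)
      (fun e he => edgeSpin_clusterFlip F x he) ?_
    rw [spin_clusterFlip_of_reachable (.refl x), spin_clusterFlip_of_not_reachable hxy]
    ring

end AshkinTeller
end

/-! ### Row expansion of the Pfaffian. -/

theorem Finset.even_card_of_involutive {ι : Type*} (T : Finset ι) (f : ι → ι)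
    (hT : ∀ i ∈ T, f i ∈ T) (hne : ∀ i ∈ T, f i ≠ i) (hf : ∀ i ∈ T, f (f i) = i) :
    Even T.card := by
  have h : ∑ i ∈ T, (1 : ZMod 2) = 0 :=
    Finset.sum_involution (fun i _ => f i) (fun _ _ => by decide) (fun i hi _ => hne i hi)
      hT hf
  rw [Finset.sum_const, nsmul_one] at h
  exact (ZMod.natCast_eq_zero_iff_even).1 h

namespace Pfaffian

variable {ι : Type*} [Fintype ι] [LinearOrder ι]

/-- The pairings of a subset `S`, extended by the identity. -/
def pairingsOn (S : Finset ι) : Finset (Equiv.Perm ι) :=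
  Finset.univ.filter fun π => (∀ i, π (π i) = i) ∧ ∀ i, π i ≠ i ↔ i ∈ S

theorem mem_pairingsOn {S : Finset ι} {π : Equiv.Perm ι} :
    π ∈ pairingsOn S ↔ (∀ i, π (π i) = i) ∧ ∀ i, π i ≠ i ↔ i ∈ S := by
  simp [pairingsOn]

/-- The signed weight of a pairing in the Pfaffian. -/
def pairingTerm {R : Type*} [CommRing R] (A : Matrix ι ι R) (π : Equiv.Perm ι) : R :=
  (-1) ^ crossings π * ∏ i ∈ Finset.univ.filter (fun i => i < π i), A i (π i)

/-- Points fixed by the extension start no chord, so crossings and factors are unchanged.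
Permutations of all of `ι` keep the type fixed while `S` shrinks in the induction. -/
theorem pf_submatrix {R : Type*} [CommRing R] (A : Matrix ι ι R) (S : Finset ι) :
    pf (A.submatrix (Subtype.val : S → ι) (Subtype.val : S → ι)) =
      ∑ π ∈ pairingsOn S, pairingTerm A π := by
  have hap : ∀ (π : Equiv.Perm S) (i : S), Equiv.Perm.ofSubtype π (i : ι) = π i := fun π i =>
    Equiv.Perm.ofSubtype_apply_coe π i
  have hnot : ∀ (π : Equiv.Perm S) (i : ι), i ∉ S → Equiv.Perm.ofSubtype π i = i := fun π i hi =>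
    Equiv.Perm.ofSubtype_apply_of_not_mem π hi
  unfold pf
  refine Finset.sum_bij (fun π _ => Equiv.Perm.ofSubtype π) ?_ ?_ ?_ ?_
  · intro π hπ
    rw [pairings, Finset.mem_filter] at hπ
    rw [mem_pairingsOn]
    refine ⟨fun i => ?_, fun i => ?_⟩ <;> by_cases hi : i ∈ S
    · lift i to S using hi
      rw [hap, hap, (hπ.2 i).2]
    · rw [hnot π i hi, hnot π i hi]
    · lift i to S using hi
      rw [hap]
      simpa [Subtype.coe_inj] using (hπ.2 i).1
    · simp [hnot π i hi, hi]
  · exact fun π _ ρ _ h => Equiv.Perm.ofSubtype_injective h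
  · intro π hπ
    rw [mem_pairingsOn] at hπ
    have hS : ∀ i, i ∈ S ↔ π i ∈ S := fun i => by
      rw [← hπ.2, ← hπ.2, hπ.1]
      exact ne_comm
    refine ⟨π.subtypePerm fun i => (hS i).symm, ?_, Equiv.Perm.ofSubtype_subtypePerm _
      fun i hi => (hπ.2 i).1 hi⟩
    rw [pairings, Finset.mem_filter]
    refine ⟨Finset.mem_univ _, fun i => ⟨fun h => (hπ.2 i).2 i.2 ?_, Subtype.ext ?_⟩⟩
    · simpa using congrArg Subtype.val h
    · simpa using hπ.1 i
  · intro π _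
    unfold pairingTerm crossings
    have hmem : ∀ i : ι, i < Equiv.Perm.ofSubtype π i → i ∈ S := fun i hi => by
      by_contra h
      exact hi.ne' (hnot π i h)
    refine congrArg₂ (· * ·) (congrArg _ ?_) ?_
    · refine Finset.card_bij (fun p _ => ((p.1 : ι), (p.2 : ι))) ?_ ?_ ?_
      · intro p hp
        simpa [hap] using hp
      · rintro ⟨p, p'⟩ _ ⟨q, q'⟩ _ h
        simpa [Subtype.coe_inj] using h
      · rintro ⟨i, k⟩ hp
        rw [Finset.mem_filter] at hp
        obtain ⟨-, h1, h2, h3⟩ := hp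
        have hi : i ∈ S := hmem i (h1.trans h2)
        have hk : k ∈ S := hmem k (h2.trans h3)
        lift i to S using hi
        lift k to S using hk
        simp only [hap, Subtype.coe_lt_coe] at h1 h2 h3
        exact ⟨(i, k), Finset.mem_filter.2 ⟨Finset.mem_univ _, h1, h2, h3⟩, rfl⟩
    · refine Finset.prod_bij (fun i _ => (i : ι)) ?_ ?_ ?_ ?_
      · intro i hi
        simpa [hap] using hi
      · exact fun i _ k _ h => Subtype.ext h
      · intro i hi
        obtain ⟨-, hi⟩ := Finset.mem_filter.1 hi
        have hiS := hmem i hi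
        lift i to S using hiS
        rw [hap, Subtype.coe_lt_coe] at hi
        exact ⟨i, Finset.mem_filter.2 ⟨Finset.mem_univ _, hi⟩, rfl⟩
      · intro i _
        simp [hap]

/-- Removing the pair of the smallest element `a` from a pairing of `S`. -/
theorem pairingTerm_eq_mul_erase {R : Type*} [CommRing R] (A : Matrix ι ι R) {S : Finset ι}
    {π ρ : Equiv.Perm ι} (hπ : π ∈ pairingsOn S) {a j : ι} (hmin : ∀ i ∈ S, a ≤ i) (haj : a < j)
    (hπa : π a = j) (hρa : ρ a = a) (hρj : ρ j = j) (hρ : ∀ i, i ≠ a → i ≠ j → ρ i = π i) :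
    pairingTerm A π =
      (-1) ^ (S.filter fun i => a < i ∧ i < j).card * A a j * pairingTerm A ρ := by
  obtain ⟨hinv, hS⟩ := mem_pairingsOn.1 hπ
  have hπj : π j = a := by rw [← hπa, hinv]
  have hSπ : ∀ i, i ∈ S → π i ∈ S := fun i hi => by
    rw [← hS, hinv]
    exact ((hS i).2 hi).symm
  have hlt : ∀ i, i < π i → a ≤ i := fun i hi => hmin i ((hS i).1 hi.ne')
  have hprod : ∏ i ∈ Finset.univ.filter (fun i => i < π i), A i (π i) =
      A a j * ∏ i ∈ Finset.univ.filter (fun i => i < ρ i), A i (ρ i) := by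
    have : Finset.univ.filter (fun i => i < π i)
        = insert a (Finset.univ.filter fun i => i < ρ i) := by
      ext i
      simp only [Finset.mem_filter, Finset.mem_univ, true_and, Finset.mem_insert]
      by_cases h1 : i = a
      · subst h1; simp [hπa, haj]
      by_cases h2 : i = j
      · subst h2; simp [hπj, hρj, haj.not_gt, h1]
      · simp [hρ i h1 h2, h1]
    rw [this, Finset.prod_insert (by simp [hρa]), hπa]
    congr 1
    refine Finset.prod_congr rfl fun i hi => ?_
    have hi := (Finset.mem_filter.1 hi).2
    rw [hρ i (by rintro rfl; simp [hρa] at hi) (by rintro rfl; simp [hρj] at hi)]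
  -- The crossings of the chord `{a, j}`: since `a` is minimal, this chord can only come first in a
  -- crossing.
  set X := Finset.univ.filter fun i => a < i ∧ i < j ∧ j < π i with hX
  have hcross : crossings π = X.card + crossings ρ := by
    unfold crossings
    rw [← Finset.card_filter_add_card_filter_not
      (s := Finset.univ.filter fun p : ι × ι => p.1 < p.2 ∧ p.2 < π p.1 ∧ π p.1 < π p.2)
      (fun p => p.1 = a)]
    congr 1
    · refine Finset.card_bij (fun p _ => p.2) ?_ ?_ ?_
      · rintro ⟨p, q⟩ hp
        simp only [Finset.mem_filter, Finset.mem_univ, true_and] at hp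
        obtain ⟨⟨h1, h2, h3⟩, rfl⟩ := hp
        rw [hπa] at h2 h3
        simpa [hX] using ⟨h1, h2, h3⟩
      · rintro ⟨p, q⟩ hp ⟨p', q'⟩ hp' h
        exact Prod.ext ((Finset.mem_filter.1 hp).2.trans (Finset.mem_filter.1 hp').2.symm) h
      · intro i hi
        exact ⟨(a, i), by simpa [hX, hπa] using hi, rfl⟩
    · congr 1
      ext ⟨p, q⟩
      simp only [Finset.mem_filter, Finset.mem_univ, true_and]
      constructor
      · rintro ⟨⟨h1, h2, h3⟩, hpa⟩
        have hap : a < p := lt_of_le_of_ne (hlt p (h1.trans h2)) (Ne.symm hpa)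
        have hpj : p ≠ j := by
          rintro rfl
          rw [hπj] at h2
          exact (haj.trans (h1.trans h2)).false
        have hqj : q ≠ j := by
          rintro rfl
          rw [hπj] at h3
          exact (haj.trans (h2.trans h3)).false
        rw [hρ p hpa hpj, hρ q (hap.trans h1).ne' hqj]
        exact ⟨h1, h2, h3⟩
      · rintro ⟨h1, h2, h3⟩
        have hpa : p ≠ a := by
          rintro rfl
          rw [hρa] at h2
          exact (h1.trans h2).false
        have hpj : p ≠ j := by
          rintro rfl
          rw [hρj] at h2
          exact (h1.trans h2).false
        have hqa : q ≠ a := by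
          rintro rfl
          rw [hρa] at h3
          exact (h2.trans h3).false
        have hqj : q ≠ j := by
          rintro rfl
          rw [hρj] at h3
          exact (h2.trans h3).false
        rw [hρ p hpa hpj] at h2
        rw [hρ p hpa hpj, hρ q hqa hqj] at h3
        exact ⟨⟨h1, h2, h3⟩, hpa⟩
  -- Points of `S` between `a` and `j` whose chord does not cross `{a, j}` are paired among
  -- themselves, so they do not change the parity.
  have hsign : (-1 : R) ^ (S.filter fun i => a < i ∧ i < j).card = (-1) ^ X.card := by
    rw [← Finset.card_filter_add_card_filter_not (s := S.filter fun i => a < i ∧ i < j)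
      (fun i => j < π i)]
    have h1 : (S.filter fun i => a < i ∧ i < j).filter (fun i => j < π i) = X := by
      ext i
      simp only [hX, Finset.mem_filter, Finset.mem_univ, true_and]
      constructor
      · rintro ⟨⟨-, h1, h2⟩, h3⟩
        exact ⟨h1, h2, h3⟩
      · rintro ⟨h1, h2, h3⟩
        exact ⟨⟨(hS i).1 (h2.trans h3).ne', h1, h2⟩, h3⟩
    have h2 : Even ((S.filter fun i => a < i ∧ i < j).filter fun i => ¬ j < π i).card := by
      refine Finset.even_card_of_involutive _ π (fun i hi => ?_) (fun i hi => ?_)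
        fun i _ => hinv i
      · simp only [Finset.mem_filter] at hi ⊢
        obtain ⟨⟨hi, h1, h2⟩, h3⟩ := hi
        refine ⟨⟨hSπ i hi, lt_of_le_of_ne (hmin _ (hSπ i hi)) ?_,
          lt_of_le_of_ne (not_lt.1 h3) ?_⟩, ?_⟩
        · intro h
          rw [h, hinv] at hπa
          exact h2.ne hπa
        · intro h
          rw [← h, hinv] at hπj
          exact h1.ne' hπj
        · rw [hinv]
          exact h2.not_gt
      · exact (hS i).2 (Finset.mem_filter.1 (Finset.mem_filter.1 hi).1).1
    rw [h1, pow_add, h2.neg_one_pow, mul_one]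
  rw [pairingTerm, pairingTerm, hprod, hcross, hsign, pow_add]
  ring

/-- Expansion of the Pfaffian along the row of the smallest element. -/
theorem sum_pairingTerm_eq {R : Type*} [CommRing R] (A : Matrix ι ι R) {S : Finset ι} {a : ι}
    (ha : a ∈ S) (hmin : ∀ i ∈ S, a ≤ i) :
    ∑ π ∈ pairingsOn S, pairingTerm A π =
      ∑ j ∈ S.erase a, (-1) ^ (S.filter fun i => a < i ∧ i < j).card * A a j *
        ∑ π ∈ pairingsOn ((S.erase a).erase j), pairingTerm A π := by
  simp_rw [Finset.mul_sum]
  rw [Finset.sum_sigma']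
  -- Composing with the transposition of `a` and its partner makes both fixed points; composing
  -- again restores the pairing.
  refine Finset.sum_bij' (fun π _ => ⟨π a, π * Equiv.swap a (π a)⟩)
    (fun p _ => p.2 * Equiv.swap a p.1) ?_ ?_ ?_ ?_ ?_
  · intro π hπ
    obtain ⟨hinv, hS⟩ := mem_pairingsOn.1 hπ
    have hπa : π a ≠ a := (hS a).2 ha
    rw [Finset.mem_sigma, mem_pairingsOn]
    refine ⟨Finset.mem_erase.2 ⟨hπa, (hS _).1 fun h => hπa (π.injective h)⟩, fun i => ?_,
      fun i => ?_⟩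
    all_goals
      by_cases h1 : i = a
      · subst h1; simp [hinv]
      by_cases h2 : i = π a
      · subst h2; simp
      have h3 : π i ≠ a := fun h => h2 (by rw [← h, hinv])
      have h4 : π i ≠ π a := fun h => h1 (π.injective h)
      simp [Equiv.swap_apply_of_ne_of_ne, h1, h2, h3, h4, hinv, ← hS]
  · rintro ⟨j, ρ⟩ hp
    rw [Finset.mem_sigma, mem_pairingsOn] at hp
    obtain ⟨hj, hinv, hS⟩ := hp
    simp only at hj hinv hS
    have hρa : ρ a = a := by by_contra h; simpa using (hS a).1 h
    have hρj : ρ j = j := by by_contra h; simpa using (hS j).1 h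
    obtain ⟨hja, hjS⟩ := Finset.mem_erase.1 hj
    rw [mem_pairingsOn]
    refine ⟨fun i => ?_, fun i => ?_⟩
    all_goals
      by_cases h1 : i = a
      · subst h1; simp [hρa, hρj, hja, ha]
      by_cases h2 : i = j
      · subst h2; simp [hρa, hρj, hja.symm, hjS]
      have h3 : ρ i ≠ a := fun h => h1 (ρ.injective (h.trans hρa.symm))
      have h4 : ρ i ≠ j := fun h => h2 (ρ.injective (h.trans hρj.symm))
      have h5 := hS i
      simp only [ne_eq, Finset.mem_erase] at h5
      simp [Equiv.swap_apply_of_ne_of_ne, h1, h2, h3, h4, hinv, h5]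
  · intro π _
    simp [mul_assoc]
  · rintro ⟨j, ρ⟩ hp
    rw [Finset.mem_sigma, mem_pairingsOn] at hp
    have hρj : ρ j = j := by by_contra h; simpa using (hp.2.2 j).1 h
    simp [hρj, mul_assoc]
  · intro π hπ
    obtain ⟨hinv, hS⟩ := mem_pairingsOn.1 hπ
    have hπa : π a ≠ a := (hS a).2 ha
    have haj : a < π a :=
      lt_of_le_of_ne (hmin _ ((hS _).1 fun h => hπa (π.injective h))) hπa.symm
    refine pairingTerm_eq_mul_erase A hπ hmin haj rfl ?_ ?_ fun i h1 h2 => ?_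
    · simp [hinv]
    · simp
    · simp [Equiv.swap_apply_of_ne_of_ne h1 h2]

theorem pairingsOn_empty : pairingsOn (∅ : Finset ι) = {1} := by
  ext π
  simp only [mem_pairingsOn, Finset.notMem_empty, iff_false, not_not, Finset.mem_singleton]
  exact ⟨fun h => Equiv.ext h.2, by rintro rfl; simp⟩

theorem pairingTerm_one {R : Type*} [CommRing R] (A : Matrix ι ι R) : pairingTerm A 1 = 1 := by
  have : crossings (1 : Equiv.Perm ι) = 0 := by
    rw [crossings, Finset.card_eq_zero, Finset.filter_eq_empty_iff]
    rintro ⟨i, k⟩ - ⟨h1, h2, -⟩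
    exact (h1.trans h2).false
  simp [pairingTerm, this]

end Pfaffian

/-! ### The quadratic recursion and the induction on `S`. -/

noncomputable section

namespace AshkinTeller

variable {V : Type*}

theorem nodeSpin_pair_mul_erase {m : ℕ} (v : Fin m → V) {S : Finset (Fin m)} {a j : Fin m}
    (ha : a ∈ S) (hj : j ∈ S.erase a) (σ : V → ℤˣ) :
    nodeSpin v ((S.erase a).erase j) σ * (spin σ (v a) * spin σ (v j)) = nodeSpin v S σ := by
  rw [nodeSpin, nodeSpin, ← Finset.mul_prod_erase S _ ha, ← Finset.mul_prod_erase _ _ hj]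
  ring

variable [Fintype V] [DecidableEq V]

/-- The quadratic recursion for boundary correlations of the planar Ising model. -/
theorem isingSum_one_mul_isingSum_nodeSpin (G : SimpleGraph V) [DecidableRel G.Adj]
    (E : PlaneEmbedding G) {m : ℕ} {v : Fin m → V} (hv : E.IsCounterclockwise v) (J : Sym2 V → ℝ)
    {S : Finset (Fin m)} {a : Fin m} (ha : a ∈ S) (hmin : ∀ i ∈ S, a ≤ i) :
    isingSum G J (nodeSpin v S) * isingSum G J (fun _ => 1) =
      ∑ j ∈ S.erase a, (-1) ^ (S.filter fun i => a < i ∧ i < j).card *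
        (isingSum G J (nodeSpin v ((S.erase a).erase j)) *
          isingSum G J fun σ => spin σ (v a) * spin σ (v j)) := by
  classical
  have hpair : ∀ j ∈ S.erase a, (-1) ^ (S.filter fun i => a < i ∧ i < j).card *
        (isingSum G J (nodeSpin v ((S.erase a).erase j)) *
          isingSum G J fun σ => spin σ (v a) * spin σ (v j)) =
      ∑ F ∈ G.edgeFinset.powerset, (-1) ^ (S.filter fun i => a < i ∧ i < j).card *
        (edgeSum F (fun e x => Real.exp (2 * J e * x) - 1) (nodeSpin v S) *
          edgeSum F (fun _ x => (1 + x) / 2) (fun τ => spin τ (v a) * spin τ (v j))) :=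
    fun j hj => by
      rw [isingSum_mul_isingSum G J _ _ fun σ τ => by rw [spin_mul, spin_mul]; ring,
        Finset.mul_sum]
      simp only [nodeSpin_pair_mul_erase v ha hj]
  rw [Finset.sum_congr rfl hpair, Finset.sum_comm,
    isingSum_mul_isingSum G J _ _ fun _ _ => (mul_one 1).symm]
  refine Finset.sum_congr rfl fun F hF => ?_
  simp only [mul_one]
  change edgeSum F _ (nodeSpin v S) * _ = _
  -- The factor common to all `j` either vanishes or forces every cluster of `F` to be even, as the
  -- sign lemma requires.
  by_cases hne : edgeSum F (fun e x => Real.exp (2 * J e * x) - 1) (nodeSpin v S) = 0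
  · simp [hne]
  let H := SimpleGraph.fromEdgeSet (F : Set (Sym2 V))
  have hH : H ≤ G := fun x y hxy => by
    have := Finset.mem_powerset.1 hF ((SimpleGraph.fromEdgeSet_adj _).1 hxy).1
    exact SimpleGraph.mem_edgeFinset.1 this
  obtain ⟨r, hr⟩ : ∃ r : Setoid (Fin m), ∀ i j, r i j ↔ H.Reachable (v i) (v j) :=
    ⟨H.reachableSetoid.comap v, fun _ _ => Iff.rfl⟩
  have hsum := Finset.sum_neg_one_pow_between_related r S
    (fun i j k l hij hjk hkl hik hjl => (hr i j).2 <|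
      hv.reachable_of_lt hH hij hjk hkl ((hr i k).1 hik) ((hr j l).1 hjl))
    (fun i => by
      simp only [hr]
      convert even_card_of_edgeSum_ne_zero v S F _ hne (v i)) ha hmin
  have hterm : ∀ j, (-1) ^ (S.filter fun i => a < i ∧ i < j).card *
        (edgeSum F (fun e x => Real.exp (2 * J e * x) - 1) (nodeSpin v S) *
          edgeSum F (fun _ x => (1 + x) / 2) (fun τ => spin τ (v a) * spin τ (v j))) =
      (edgeSum F (fun e x => Real.exp (2 * J e * x) - 1) (nodeSpin v S) *
        edgeSum F (fun _ x => (1 + x) / 2) fun _ => 1) *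
        if r a j then (-1) ^ (S.filter fun i => a < i ∧ i < j).card else 0 := fun j => by
    rw [edgeSum_spin_mul_spin]
    by_cases h : r a j
    · rw [if_pos h, if_pos ((hr a j).1 h)]; ring
    · rw [if_neg h, if_neg fun h' => h ((hr a j).2 h')]; ring
  rw [Finset.sum_congr rfl fun j _ => hterm j, ← Finset.mul_sum, ← Finset.sum_filter, hsum,
    mul_one]

theorem corr_eq_sum (G : SimpleGraph V) [DecidableRel G.Adj] (E : PlaneEmbedding G) {m : ℕ}
    {v : Fin m → V} (hv : E.IsCounterclockwise v) (J U : Sym2 V → ℝ)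
    (hU : ∀ e ∈ G.edgeSet, U e = 0) {S : Finset (Fin m)} {a : Fin m} (ha : a ∈ S)
    (hmin : ∀ i ∈ S, a ≤ i) :
    corr G J U v S = ∑ j ∈ S.erase a, (-1) ^ (S.filter fun i => a < i ∧ i < j).card *
      kernelMatrix G J U v a j * corr G J U v ((S.erase a).erase j) := by
  have hZ := (isingSum_one_pos G J).ne'
  have hcorr : ∀ T, corr G J U v T = isingSum G J (nodeSpin v T) / isingSum G J fun _ => 1 :=
    fun T => expect_eq_isingSum_div G J U hU _
  have hker : ∀ j ∈ S.erase a, kernelMatrix G J U v a j =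
      (isingSum G J fun σ => spin σ (v a) * spin σ (v j)) / isingSum G J fun _ => 1 := by
    intro j hj
    obtain ⟨hja, hj⟩ := Finset.mem_erase.1 hj
    rw [kernelMatrix, Matrix.of_apply, if_neg hja.symm, if_neg (hmin j hj).not_gt, one_mul,
      expect_eq_isingSum_div G J U hU]
  -- Expanding the fraction by the Ising partition function makes the numerator the quadratic
  -- expression of the recursion.
  rw [hcorr, ← mul_div_mul_right _ _ hZ,
    isingSum_one_mul_isingSum_nodeSpin G E hv J ha hmin, Finset.sum_div]
  refine Finset.sum_congr rfl fun j hj => ?_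
  rw [hker j hj, hcorr]
  field_simp

theorem corr_empty (G : SimpleGraph V) [DecidableRel G.Adj] (J U : Sym2 V → ℝ)
    (hU : ∀ e ∈ G.edgeSet, U e = 0) {m : ℕ} (v : Fin m → V) : corr G J U v ∅ = 1 := by
  rw [corr, expect_eq_isingSum_div G J U hU]
  simpa using div_self (isingSum_one_pos G J).ne'

theorem corr_eq_sum_pairingTerm (G : SimpleGraph V) [DecidableRel G.Adj] (E : PlaneEmbedding G)
    {m : ℕ} {v : Fin m → V} (hv : E.IsCounterclockwise v) (J U : Sym2 V → ℝ)
    (hU : ∀ e ∈ G.edgeSet, U e = 0) (S : Finset (Fin m)) :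
    corr G J U v S =
      ∑ π ∈ Pfaffian.pairingsOn S, Pfaffian.pairingTerm (kernelMatrix G J U v) π := by
  induction S using Finset.strongInduction with
  | H S ih =>
    rcases S.eq_empty_or_nonempty with rfl | hne
    · rw [corr_empty G J U hU, Pfaffian.pairingsOn_empty, Finset.sum_singleton,
        Pfaffian.pairingTerm_one]
    · have ha := S.min'_mem hne
      have hmin : ∀ i ∈ S, S.min' hne ≤ i := fun i hi => S.min'_le i hi
      rw [corr_eq_sum G E hv J U hU ha hmin, Pfaffian.sum_pairingTerm_eq _ ha hmin]
      refine Finset.sum_congr rfl fun j _ => ?_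
      rw [ih _ ((Finset.erase_subset _ _).trans_ssubset (Finset.erase_ssubset ha))]

end AshkinTeller

end

theorem corollary4 {V : Type*} [Fintype V] [DecidableEq V]
    (G : SimpleGraph V) [DecidableRel G.Adj] (hG : G.Connected)
    (E : PlaneEmbedding G) {m : ℕ} (v : Fin m → V) (hv : E.IsCounterclockwise v)
    (J U : Sym2 V → ℝ) (hU : ∀ e ∈ G.edgeSet, U e = 0)
    (S : Finset (Fin m)) (hS : Even S.card) :
    AshkinTeller.corr G J U v S =
      Pfaffian.pf ((AshkinTeller.kernelMatrix G J U v).submatrix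
        (Subtype.val : S → Fin m) (Subtype.val : S → Fin m)) := by
  rw [Pfaffian.pf_submatrix, AshkinTeller.corr_eq_sum_pairingTerm G E hv J U hU S]
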